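/- **Conventions.** A *representation* of a set $X$ is a surjective partial map $\delta_X:\subseteq\mathbb{N}^{\mathbb{N}}\to X$; then $(X,\delta_X)$ is a *represented space* and carries the *final topology* $\mathcal{O}(X)=\{U\subseteq X:\delta_X^{-1}(U)\text{ is open in }\mathrm{dom}(\delta_X)\}$. A partial map $f:\subseteq X\to Y$ between represented spaces is *computable* (*continuous*) if there is a computable (continuous) $F:\subseteq\mathbb{N}^{\mathbb{N}}\to\mathbb{N}^{\mathbb{N}}$ with $\delta_Y(F(p))=f(\delta_X(p))$ for all $p\in\mathrm{dom}(f\circ\delta_X)$. A *computable embedding* is an injective computable map $f:X\to Y$ whose partial inverse $f^{-1}:\subseteq Y\to X$ is computable. Sierpiński space $\mathbb{S}=\{0,1\}$ is represented by $\delta_{\mathbb{S}}(p)=0\iff p=000\dots$. For $q\in\mathbb{N}^{\mathbb{N}}$ let $\eta_q:\subseteq\mathbb{N}^{\mathbb{N}}\to\mathbb{N}^{\mathbb{N}}$ be the partial continuous function with Kleene associate $q$, i.e. $\eta_q(p)(n)=m$ iff $q(\langle n,p(0),\dots,p(k-1)\rangle)=m+1$ for the least $k$ at which $q(\langle n,p(0),\dots,p(k-1)\rangle)\neq0$;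 a partial function on $\mathbb{N}^{\mathbb{N}}$ is computable iff it is a restriction of some $\eta_q$ with $q$ computable. The set $\mathcal{O}(X)$ is itself represented by the function space representation of the continuous maps $X\to\mathbb{S}$: $\delta_{\mathcal{O}(X)}(q)=U$ iff $\eta_q$ realizes the characteristic function $\chi_U:X\to\mathbb{S}$. A represented space $X$ is a *computable Kolmogorov space* if $\mathcal{U}:X\to\mathcal{O}\mathcal{O}(X)$, $x\mapsto\{U\in\mathcal{O}(X):x\in U\}$, is a computable embedding. A representation $\delta_X$ is *admissible* with respect to a topology $\tau$ on $X$ if $\delta_X$ is continuous with respect to $\tau$ and every representation $\delta$ of $X$ that is continuous with respect to $\tau$ is also continuous with respect to $\delta_X$, i.e. $\delta=\delta_X\circ F$ on $\mathrm{dom}(\delta)$ for some continuous $F:\subseteq\mathbb{N}^{\mathbb{N}}\to\mathbb{N}^{\mathbb{N}}$. **Theorem (Presubbase theorem).** Let $X$ be a set, let $Y$ be a represented space and let $(B_y)_{y\in Y}$ be a *presubbase* of $X$, i.e. a family of subsets of $X$ such that the transpose $B^{\mathsf T}:X\to\mathcal{O}(Y)$, $x\mapsto\{y\in Y:x\in B_y\}$,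 is well defined (all these sets are open in $Y$) and injective. Let $\delta^B:\subseteq\mathbb{N}^{\mathbb{N}}\to X$ be the *presubbase representation*, given by $\delta^B(p)=x\iff\delta_{\mathcal{O}(Y)}(p)=\{y\in Y:x\in B_y\}$. Then $(X,\delta^B)$ is a computable Kolmogorov space. Moreover, the set $X$ and the sets $\bigcap_{y\in K}B_y$, for all compact $K\subseteq Y$ (compactness with respect to the final topology of $Y$, no Hausdorff condition), form a base of the topology $\tau$ on $X$ that they generate, and $\delta^B$ is admissible with respect to $\tau$. -/

import Mathlib

namespace CompAn

universe u v

open scoped Topology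

/-- Baire space, with the product topology of discrete spaces (Mathlib's instance on `ℕ → ℕ`). -/
abbrev Baire : Type := ℕ → ℕ

/-- A representation of `X`: a surjective partial map from Baire space to `X`. -/
structure Representation (X : Type u) where
  toPFun : Baire →. X
  surj : ∀ x : X, ∃ p : Baire, x ∈ toPFun p

/-- Code of the finite word `n, p 0, …, p (k - 1)`. -/
def prefixCode (n : ℕ) (p : Baire) (k : ℕ) : ℕ :=
  Encodable.encode (n :: (List.range k).map p)

/-- The partial function on Baire space with Kleene associate `q`: to find the `n`-th value at `p`,
feed longer and longer prefixes of `p` to `q`, until `q` answers with some `m + 1`; then the value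
is `m`. The function is defined at `p` if all values are found. -/
def eta (q : Baire) : Baire →. Baire := fun p =>
  { Dom := ∀ n, ∃ k, q (prefixCode n p k) ≠ 0
    get := fun h n => q (prefixCode n p (Nat.find (h n))) - 1 }

/-- A partial function on Baire space is computable if it has a computable associate. -/
def IsComputable (F : Baire →. Baire) : Prop :=
  ∃ a : ℕ → ℕ, Computable a ∧ ∀ p r, r ∈ F p → r ∈ eta a p

/-- `F` realizes the partial map `f` with respect to the two representations. -/
def Realizes {X : Type u} {Y : Type v} (δX : Representation X) (δY : Representation Y)
    (F : Baire →. Baire) (f : X →. Y) : Prop :=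
  ∀ p x y, x ∈ δX.toPFun p → y ∈ f x → ∃ r ∈ F p, y ∈ δY.toPFun r

/-- Computability of a partial map between represented spaces. -/
def ComputableRepMap {X : Type u} {Y : Type v} (δX : Representation X) (δY : Representation Y)
    (f : X →. Y) : Prop :=
  ∃ F : Baire →. Baire, IsComputable F ∧ Realizes δX δY F f

/-- Continuity of a partial map between represented spaces, in the sense of having a realizer that
is continuous on its domain. -/
def ContinuousRepMap {X : Type u} {Y : Type v} (δX : Representation X) (δY : Representation Y)
    (f : X →. Y) : Prop :=
  ∃ F : Baire →. Baire, Continuous F.asSubtype ∧ Realizes δX δY F f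

/-- The inverse, with domain the range of `f`, of an injective map `f`. -/
noncomputable def partialInverse {X : Type u} {Y : Type v} (f : X → Y) : Y →. X := fun y =>
  { Dom := ∃ x, f x = y
    get := fun h => h.choose }

/-- Computable embeddings of represented spaces. -/
def ComputableEmbedding {X : Type u} {Y : Type v} (δX : Representation X) (δY : Representation Y)
    (f : X → Y) : Prop :=
  Function.Injective f ∧ ComputableRepMap δX δY (f : X →. Y) ∧
    ComputableRepMap δY δX (partialInverse f)

/-- The partial map whose graph is the single-valued relation `R`. -/
noncomputable def pfunOfRel {X : Type u} (R : Baire → X → Prop) : Baire →. X := fun p =>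
  { Dom := ∃ x, R p x
    get := fun h => h.choose }

theorem mem_pfunOfRel {X : Type u} {R : Baire → X → Prop}
    (hR : ∀ p x y, R p x → R p y → x = y) (p : Baire) (x : X) :
    x ∈ pfunOfRel R p ↔ R p x := by
  constructor
  · rintro ⟨h, rfl⟩
    exact h.choose_spec
  · intro h
    exact ⟨⟨x, h⟩, hR _ _ _ (Exists.choose_spec (⟨x, h⟩ : ∃ x, R p x)) h⟩

/-- Baire space represented by the identity. -/
def baireRep : Representation Baire where
  toPFun := PFun.id Baire
  surj := fun x => ⟨x, by simp⟩

/-- Sierpiński space, with carrier `Prop`: the zero sequence is the only name of `False`, every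
other sequence is a name of `True`. -/
def sierpinskiRep : Representation Prop where
  toPFun := fun p => Part.some (∃ n, p n ≠ 0)
  surj := fun P => by
    by_cases h : P
    · exact ⟨fun _ => 1, by simp [h]⟩
    · exact ⟨fun _ => 0, by simp [h]⟩

/-- The final topology of a represented space. -/
@[reducible]
def Representation.finalTopology {X : Type u} (δ : Representation X) : TopologicalSpace X :=
  TopologicalSpace.coinduced δ.toPFun.asSubtype inferInstance

/-- The set of open subsets of a represented space. -/
def OpenSets {X : Type u} (δ : Representation X) : Type u :=
  {U : Set X // IsOpen[δ.finalTopology] U}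

/-- `q` is a name of the function `f` in the function space representation. -/
def FunctionName {X : Type u} {Y : Type v} (δX : Representation X) (δY : Representation Y)
    (q : Baire) (f : X → Y) : Prop :=
  Realizes δX δY (eta q) (f : X →. Y)

/-- `q` is a name of the open set `U`, if it is a name of its characteristic function
with values in Sierpiński space. -/
def OpenName {X : Type u} (δ : Representation X) (q : Baire) (U : OpenSets δ) : Prop :=
  FunctionName δ sierpinskiRep q (fun x => x ∈ U.1)

theorem OpenName.exists_iff {X : Type u} {δ : Representation X} {q : Baire} {U : OpenSets δ}
    (h : OpenName δ q U) {p : Baire} {x : X} (hx : x ∈ δ.toPFun p) :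
    ∃ r ∈ eta q p, (x ∈ U.1 ↔ ∃ n, r n ≠ 0) := by
  obtain ⟨r, hr, hr'⟩ := h p x (x ∈ U.1) hx (by simp)
  refine ⟨r, hr, ?_⟩
  simp only [sierpinskiRep, Part.mem_some_iff] at hr'
  exact iff_of_eq hr'

theorem OpenName.unique {X : Type u} {δ : Representation X} (q : Baire) (U V : OpenSets δ)
    (hU : OpenName δ q U) (hV : OpenName δ q V) : U = V := by
  refine Subtype.ext (Set.ext fun x => ?_)
  obtain ⟨p, hp⟩ := δ.surj x
  obtain ⟨r, hr, h1⟩ := hU.exists_iff hp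
  obtain ⟨s, hs, h2⟩ := hV.exists_iff hp
  rw [h1, h2, Part.mem_unique hr hs]

theorem OpenName.exists {X : Type u} {δ : Representation X} (U : OpenSets δ) :
    ∃ q, OpenName δ q U := by
  classical
  obtain ⟨V, hVo, hV⟩ : ∃ V : Set Baire, IsOpen V ∧
      ∀ p x, x ∈ δ.toPFun p → (x ∈ U.1 ↔ p ∈ V) := by
    obtain ⟨V, hVo, hV⟩ := isOpen_induced_iff.1 (isOpen_coinduced.1 U.2)
    refine ⟨V, hVo, fun p x hx => ?_⟩
    have hd : p ∈ δ.toPFun.Dom := Part.dom_iff_mem.2 ⟨x, hx⟩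
    have h2 : ((⟨p, hd⟩ : δ.toPFun.Dom) ∈ Subtype.val ⁻¹' V) ↔
        ((⟨p, hd⟩ : δ.toPFun.Dom) ∈ δ.toPFun.asSubtype ⁻¹' U.1) := by rw [hV]
    have h3 : δ.toPFun.asSubtype ⟨p, hd⟩ = x := Part.get_eq_of_mem hx _
    rw [Set.mem_preimage, Set.mem_preimage, h3] at h2
    exact h2.symm
  -- a word is accepted if its cylinder is contained in `V`
  let good : List ℕ → Prop := fun l => ∀ p : Baire, (List.range l.length).map p = l → p ∈ V
  let ans : List ℕ → ℕ := fun l =>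
    match l with
    | [] => 0
    | n :: l => if l.length < n then 0 else if good l then 2 else 1
  let q : Baire := fun c => ((Encodable.decode c : Option (List ℕ)).map ans).getD 0
  have hq : ∀ n p k, q (prefixCode n p k) =
      if k < n then 0 else if good ((List.range k).map p) then 2 else 1 := by
    intro n p k
    simp [q, prefixCode, ans]
  have hgood : ∀ (p : Baire) k, good ((List.range k).map p) ↔
      ∀ s : Baire, (∀ i < k, s i = p i) → s ∈ V := by
    intro p k
    simp [good]
  refine ⟨q, fun p x y hx hy => ?_⟩
  have hy' : y = (x ∈ U.1) := by simpa using hy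
  subst hy'
  have hd : ∀ n, ∃ k, q (prefixCode n p k) ≠ 0 := by
    intro n
    refine ⟨n, ?_⟩
    rw [hq]
    split_ifs <;> simp_all
  have hfind : ∀ n, Nat.find (hd n) = n := by
    intro n
    rw [Nat.find_eq_iff]
    constructor
    · rw [hq]
      split_ifs <;> simp_all
    · intro k hk
      rw [hq]
      simp [hk]
  refine ⟨_, ⟨hd, rfl⟩, ?_⟩
  simp only [sierpinskiRep, Part.mem_some_iff]
  refine propext ?_
  rw [hV p x hx]
  have hval : ∀ n, (eta q p).get hd n ≠ 0 ↔ good ((List.range n).map p) := by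
    intro n
    have : (eta q p).get hd n = q (prefixCode n p (Nat.find (hd n))) - 1 := rfl
    rw [this, hfind, hq]
    split_ifs <;> simp_all
  simp only [hval, hgood]
  constructor
  · intro hp
    have hnhds := hVo.mem_nhds hp
    rw [nhds_pi, Filter.mem_pi] at hnhds
    obtain ⟨I, hI, t, ht, hsub⟩ := hnhds
    obtain ⟨n, hn⟩ := hI.bddAbove
    refine ⟨n + 1, fun s hs => hsub ?_⟩
    intro i hi
    rw [hs i (Nat.lt_succ_of_le (hn hi))]
    exact mem_of_mem_nhds (ht i)
  · rintro ⟨n, hn⟩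
    exact hn p fun _ _ => rfl

/-- The standard representation of the set of open subsets. -/
noncomputable def openRep {X : Type u} (δ : Representation X) : Representation (OpenSets δ) where
  toPFun := pfunOfRel (OpenName δ)
  surj := fun U => by
    obtain ⟨q, hq⟩ := OpenName.exists U
    exact ⟨q, (mem_pfunOfRel OpenName.unique q U).2 hq⟩

theorem mem_openRep {X : Type u} (δ : Representation X) (q : Baire) (U : OpenSets δ) :
    U ∈ (openRep δ).toPFun q ↔ OpenName δ q U :=
  mem_pfunOfRel OpenName.unique q U

theorem mem_eta_iff (q p r : Baire) : r ∈ eta q p ↔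
    ∀ n, ∃ k, q (prefixCode n p k) = r n + 1 ∧ ∀ j < k, q (prefixCode n p j) = 0 := by
  constructor
  · rintro ⟨h, rfl⟩ n
    have h' : ∀ n, ∃ k, q (prefixCode n p k) ≠ 0 := h
    refine ⟨Nat.find (h' n), ?_, fun j hj => by simpa using Nat.find_min (h' n) hj⟩
    have hs := Nat.find_spec (h' n)
    change _ = q (prefixCode n p (Nat.find (h' n))) - 1 + 1
    omega
  · intro h
    have h' : ∀ n, ∃ k, q (prefixCode n p k) ≠ 0 := fun n => by
      obtain ⟨k, hk, -⟩ := h n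
      exact ⟨k, by omega⟩
    refine ⟨h', funext fun n => ?_⟩
    obtain ⟨k, hk, hj⟩ := h n
    have hf : Nat.find (h' n) = k := by
      rw [Nat.find_eq_iff]
      exact ⟨by omega, fun j hjk => by simpa using hj j hjk⟩
    change q (prefixCode n p (Nat.find (h' n))) - 1 = r n
    rw [hf, hk]
    rfl

/-- The open neighbourhoods of a point form an open subset of the space of open sets. -/
theorem isOpen_neighbourhoods {X : Type u} (δ : Representation X) (x : X) :
    IsOpen[(openRep δ).finalTopology] {U : OpenSets δ | x ∈ U.1} := by
  obtain ⟨p, hp⟩ := δ.surj x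
  rw [Representation.finalTopology, isOpen_coinduced, isOpen_induced_iff]
  refine ⟨⋃ n, ⋃ k, {q : Baire | 2 ≤ q (prefixCode n p k) ∧ ∀ j < k, q (prefixCode n p j) = 0},
    ?_, ?_⟩
  · refine isOpen_iUnion fun n => isOpen_iUnion fun k => ?_
    have h1 : IsOpen {q : Baire | 2 ≤ q (prefixCode n p k)} :=
      (isOpen_discrete (Set.Ici 2)).preimage (continuous_apply (prefixCode n p k))
    have h2 : IsOpen (⋂ j ∈ Set.Iio k, {q : Baire | q (prefixCode n p j) = 0}) :=
      (Set.finite_Iio k).isOpen_biInter fun j _ =>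
        (isOpen_discrete {0}).preimage (continuous_apply (prefixCode n p j))
    convert h1.inter h2 using 1
    ext q
    simp
  · ext ⟨q, hq⟩
    set U : OpenSets δ := (openRep δ).toPFun.asSubtype ⟨q, hq⟩ with hU
    have hqU : OpenName δ q U := (mem_openRep δ q U).1 ⟨hq, rfl⟩
    obtain ⟨r, hr, hiff⟩ := hqU.exists_iff hp
    rw [mem_eta_iff] at hr
    rw [Set.mem_preimage, Set.mem_preimage, ← hU, Set.mem_ofPred_eq, hiff]
    simp only [Set.mem_iUnion, Set.mem_ofPred_eq]
    refine exists_congr fun n => ?_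
    obtain ⟨k, hk, hj⟩ := hr n
    constructor
    · rintro ⟨k', hk', hj'⟩
      have : k' = k := by
        rcases lt_trichotomy k k' with h | h | h
        · have := hj' k h; omega
        · exact h.symm
        · have := hj k' h; omega
      subst this
      omega
    · intro h
      exact ⟨k, by omega, hj⟩

/-- The neighbourhood map `x ↦ {U : x ∈ U}` from a represented space to the space of open sets of
its space of open sets. -/
def neighbourhoodMap {X : Type u} (δ : Representation X) (x : X) : OpenSets (openRep δ) :=
  ⟨{U : OpenSets δ | x ∈ U.1}, isOpen_neighbourhoods δ x⟩

/-- Computable Kolmogorov spaces: the neighbourhood map is a computable embedding. -/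
def Representation.IsComputableKolmogorov {X : Type u} (δ : Representation X) : Prop :=
  ComputableEmbedding δ (openRep (openRep δ)) (neighbourhoodMap δ)

/-- A representation is continuous with respect to a topology `τ` if it is continuous as a
map on its domain, a subspace of Baire space. -/
def Representation.ContinuousWrt {X : Type u} (δ : Representation X) (τ : TopologicalSpace X) :
    Prop :=
  Continuous[inferInstance, τ] δ.toPFun.asSubtype

/-- Admissibility with respect to a topology `τ`. -/
def Representation.IsAdmissible {X : Type u} (δX : Representation X) (τ : TopologicalSpace X) :
    Prop :=
  δX.ContinuousWrt τ ∧
    ∀ δ : Representation X, δ.ContinuousWrt τ → ContinuousRepMap baireRep δX δ.toPFun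

/-- The family `B`, indexed by a represented space, is a presubbase: its transpose
`x ↦ {y : x ∈ B y}` takes open sets as values and is injective. -/
structure IsPresubbase {X : Type u} {Y : Type v} (δY : Representation Y) (B : Y → Set X) :
    Prop where
  isOpen : ∀ x : X, IsOpen[δY.finalTopology] {y : Y | x ∈ B y}
  injective : Function.Injective fun x : X => {y : Y | x ∈ B y}

/-- The transpose of a presubbase. -/
def transpose {X : Type u} {Y : Type v} {δY : Representation Y} {B : Y → Set X}
    (hB : IsPresubbase δY B) (x : X) : OpenSets δY :=
  ⟨{y : Y | x ∈ B y}, hB.isOpen x⟩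

theorem presubbase_unique {X : Type u} {Y : Type v} {δY : Representation Y} {B : Y → Set X}
    (hB : IsPresubbase δY B) (p : Baire) (x x' : X)
    (h : transpose hB x ∈ (openRep δY).toPFun p) (h' : transpose hB x' ∈ (openRep δY).toPFun p) :
    x = x' :=
  hB.injective (congrArg Subtype.val (Part.mem_unique h h'))

/-- The presubbase representation: `p` is a name of `x` if and only if `p` is a name of the open
set `{y : x ∈ B y}`. -/
noncomputable def presubbaseRep {X : Type u} {Y : Type v} {δY : Representation Y}
    {B : Y → Set X} (hB : IsPresubbase δY B) : Representation X where
  toPFun := pfunOfRel fun p x => transpose hB x ∈ (openRep δY).toPFun p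
  surj := fun x => by
    obtain ⟨p, hp⟩ := (openRep δY).surj (transpose hB x)
    exact ⟨p, (mem_pfunOfRel (presubbase_unique hB) p x).2 hp⟩

theorem mem_presubbaseRep {X : Type u} {Y : Type v} {δY : Representation Y} {B : Y → Set X}
    (hB : IsPresubbase δY B) (p : Baire) (x : X) :
    x ∈ (presubbaseRep hB).toPFun p ↔ transpose hB x ∈ (openRep δY).toPFun p :=
  mem_pfunOfRel (presubbase_unique hB) p x

/-- The whole space and the intersections of the `B y` over compact sets of indices. -/
def compactIntersections {X : Type u} {Y : Type v} (δY : Representation Y) (B : Y → Set X) :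
    Set (Set X) :=
  {Set.univ} ∪ {A | ∃ K : Set Y, @IsCompact Y δY.finalTopology K ∧ A = ⋂ y ∈ K, B y}

/-- The topology generated by `compactIntersections`. -/
@[reducible]
def compactIntersectionTopology {X : Type u} {Y : Type v} (δY : Representation Y)
    (B : Y → Set X) : TopologicalSpace X :=
  TopologicalSpace.generateFrom (compactIntersections δY B)

end CompAn

/-!
Everything rests on one open set `O` of pairs `(q, p)` in Baire space: those for which a finite
computation shows that `η_q(p)` has a nonzero value. If `q` names an open set `U` and `p` names a
point `x`, then `x ∈ U` if and only if `(q, p) ∈ O`. Conversely, if `p` is a parameter and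
membership in `U` is semidecided by inspecting longer and longer prefixes of `p` and of a name of
the point, then a name of `U` is obtained continuously from `p`, and computably if the inspection
is primitive recursive.

*Kolmogorov property.* Membership is symmetric in the point and the open set, so the same operator
turns a name of `x` into one of `{U | x ∈ U}` and a name of `y` into one of `B y`. Hence a name
`s` of `{U | x ∈ U}` yields one of `{y | x ∈ B y}`, that is, of `x`: ask `s` about `B y`.

*Continuity.* The intersection of the open sets with a name in a compact set is open, by the tube
lemma for `O`. If names `q m` of open sets `V m` converge to a name of `U ⊇ K`, the intersections
of `U` with the `V m`, `m ≥ n`, are therefore open, and they increase and cover `K`; so `K ⊆ V n`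
for some `n`.

*Admissibility.* If `δ` is continuous, `p m → p` are names of points `x m`, `x`, and `z m → z` are
names of indices `y m`, `y` with `x ∈ B y`, then the tails of `y m`, together with `y`, form a
compact set `K`, and `x m` is eventually in the open set `⋂ y ∈ K, B y`. So `x ∈ B y` is
semidecided from prefixes of `p` and `z`, which gives the continuous translation of `δ` into
`δ^B`.
-/

namespace CompAn

open Filter PiNat Topology

section Local

/-- A sequence of functions on Baire space is local if the `n`-th one depends only on the first
`n` values of its argument. This is the form of continuity in which associates are easy to write
down; relations between points of Baire space are covered by taking `α` to be `Baire → Prop`. -/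
def IsLocal {α : Sort*} (A : ℕ → Baire → α) : Prop :=
  ∀ n ⦃p p' : Baire⦄, p' ∈ cylinder p n → A n p' = A n p

theorem IsLocal.of_imp {R : ℕ → Baire → Prop}
    (h : ∀ n ⦃p p' : Baire⦄, p' ∈ cylinder p n → R n p → R n p') : IsLocal R :=
  fun n p p' hp => propext ⟨h n ((mem_cylinder_comm p p' n).1 hp), h n hp⟩

theorem IsLocal.continuous {Φ : Baire → Baire} (hΦ : IsLocal fun n p => Φ p n) : Continuous Φ :=
  continuous_pi fun n => IsLocallyConstant.continuous <|
    (IsLocallyConstant.iff_eventually_eq _).2 fun p =>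
      mem_of_superset ((isOpen_cylinder _ p n).mem_nhds (self_mem_cylinder p n))
        fun _ hp => hΦ n hp

theorem isOpen_setOf_exists_of_isLocal {R : ℕ → Baire → Baire → Prop} (hR : IsLocal R)
    (hR' : ∀ p, IsLocal fun n => R n p) : IsOpen {a : Baire × Baire | ∃ n, R n a.1 a.2} := by
  refine isOpen_iff_mem_nhds.2 fun a ⟨n, hn⟩ => ?_
  have hcyl (p : Baire) : cylinder p n ∈ 𝓝 p :=
    (isOpen_cylinder _ p n).mem_nhds (self_mem_cylinder p n)
  refine mem_of_superset (prod_mem_nhds (hcyl a.1) (hcyl a.2)) fun b hb => ⟨n, ?_⟩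
  rw [hR n hb.1]
  exact (hR' a.1 n hb.2).mpr hn

theorem exists_cylinder_prod_subset_iff {G : Set (Baire × Baire)} {p z : Baire} :
    (∃ n, cylinder p n ×ˢ cylinder z n ⊆ G) ↔ G ∈ 𝓝 (p, z) := by
  constructor
  · rintro ⟨n, hn⟩
    exact mem_of_superset (prod_mem_nhds
      ((isOpen_cylinder _ p n).mem_nhds (self_mem_cylinder p n))
      ((isOpen_cylinder _ z n).mem_nhds (self_mem_cylinder z n))) hn
  · intro hG
    have exists_cylinder_subset {p : Baire} {V : Set Baire} (hV : V ∈ 𝓝 p) :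
        ∃ n, cylinder p n ⊆ V := by
      obtain ⟨_, ⟨p', n, rfl⟩, hp, hsub⟩ :=
        (isTopologicalBasis_cylinders fun _ => ℕ).mem_nhds_iff.1 hV
      exact ⟨n, mem_cylinder_iff_eq.1 hp ▸ hsub⟩
    obtain ⟨V, hV, W, hW, hVW⟩ := mem_nhds_prod_iff.1 hG
    obtain ⟨m, hm⟩ := exists_cylinder_subset hV
    obtain ⟨n, hn⟩ := exists_cylinder_subset hW
    exact ⟨max m n, (Set.prod_mono ((cylinder_anti p (le_max_left m n)).trans hm)
      ((cylinder_anti z (le_max_right m n)).trans hn)).trans hVW⟩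

end Local

section Associates

/-- The sequence that starts with the word `l` and continues with zeros. It turns functions of
finite prefixes into functions on Baire space. -/
def word (l : List ℕ) : Baire := fun i => l.getD i 0

theorem word_map_range_mem_cylinder (p : Baire) (n : ℕ) :
    word ((List.range n).map p) ∈ cylinder p n :=
  fun i hi => by simp [word, hi]

theorem primrec_word : Primrec₂ word :=
  Primrec.list_getD 0

theorem prefixCode_congr {p p' : Baire} {k : ℕ} (h : p' ∈ cylinder p k) (n : ℕ) :
    prefixCode n p' k = prefixCode n p k := by
  have : (List.range k).map p' = (List.range k).map p :=
    List.map_congr_left fun i hi => h i (List.mem_range.1 hi)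
  rw [prefixCode, prefixCode, this]

theorem primrec_prefixCode {α : Type*} [Primcodable α] {n k : α → ℕ} {f : α → Baire}
    (hn : Primrec n) (hf : Primrec₂ f) (hk : Primrec k) :
    Primrec fun x => prefixCode (n x) (f x) (k x) :=
  Primrec.encode.comp (Primrec.list_cons.comp hn (Primrec.list_map (Primrec.list_range.comp hk) hf))

/-- An associate of the function `p ↦ (A n p)ₙ`, for a local sequence `A`: it answers the query for
the `n`-th value as soon as it has seen `n` values of the argument. -/
def localAssociate (A : ℕ → Baire → ℕ) : Baire := fun c =>
  let l := Denumerable.ofNat (List ℕ) c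
  if l.length = l.headI + 1 then A l.headI (word l.tail) + 1 else 0

theorem localAssociate_prefixCode (A : ℕ → Baire → ℕ) (n : ℕ) (p : Baire) (k : ℕ) :
    localAssociate A (prefixCode n p k) =
      if k = n then A n (word ((List.range k).map p)) + 1 else 0 := by
  have : Denumerable.ofNat (List ℕ) (prefixCode n p k) = n :: (List.range k).map p :=
    Denumerable.ofNat_encode _
  simp [localAssociate, this]

theorem mem_eta_localAssociate {A : ℕ → Baire → ℕ} (hA : IsLocal A) (p : Baire) :
    (fun n => A n p) ∈ eta (localAssociate A) p := by
  refine (mem_eta_iff _ _ _).2 fun n => ⟨n, ?_, fun k hk => ?_⟩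
  · rw [localAssociate_prefixCode, if_pos rfl, hA n (word_map_range_mem_cylinder p n)]
  · rw [localAssociate_prefixCode, if_neg hk.ne]

theorem headI_ofNat_le (c : ℕ) : (Denumerable.ofNat (List ℕ) c).headI ≤ c := by
  obtain ⟨l, rfl⟩ : ∃ l : List ℕ, Encodable.encode l = c := ⟨_, Denumerable.encode_ofNat c⟩
  rw [Denumerable.ofNat_encode]
  cases l with
  | nil => exact Nat.zero_le _
  | cons n l => exact (Nat.left_le_pair n _).trans (Nat.le_succ _)

theorem isLocal_localAssociate {A : ℕ → Baire → Baire → ℕ} (hA : IsLocal A) :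
    IsLocal fun c p => localAssociate (fun n => A n p) c := by
  intro c p p' h
  simp only [localAssociate, hA _ (cylinder_anti p (headI_ofNat_le c) h)]

theorem primrec_localAssociate {α : Type*} [Primcodable α] {A : α → ℕ → Baire → ℕ}
    (hA : Primrec fun x : α × ℕ × List ℕ => A x.1 x.2.1 (word x.2.2)) :
    Primrec₂ fun x => localAssociate (A x) := by
  have hl : Primrec fun x : α × ℕ => Denumerable.ofNat (List ℕ) x.2 :=
    (Primrec.ofNat (List ℕ)).comp Primrec.snd
  have hn := Primrec.list_headI.comp hl
  exact Primrec.ite (Primrec.eq.comp (Primrec.list_length.comp hl) (Primrec.succ.comp hn))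
    (Primrec.succ.comp (hA.comp (Primrec.fst.pair (hn.pair (Primrec.list_tail.comp hl)))))
    (Primrec.const 0)

theorem IsLocal.isComputable {Φ : Baire → Baire} (hΦ : IsLocal fun n p => Φ p n)
    (hword : Primrec₂ fun l : List ℕ => Φ (word l)) : IsComputable (Φ : Baire →. Baire) := by
  refine ⟨localAssociate fun n p => Φ p n, ?_, fun p r hr => ?_⟩
  · have := primrec_localAssociate (α := Unit) (A := fun _ n p => Φ p n)
      (hword.comp (Primrec.snd.comp Primrec.snd) (Primrec.fst.comp Primrec.snd))
    exact (this.comp (Primrec.const ()) Primrec.id).to_comp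
  · obtain rfl : r = Φ p := by simpa using hr
    exact mem_eta_localAssociate hΦ p

end Associates

section Semideciders

open Classical in
/-- For a local sequence `R` of predicates, a name of the open set `{z | ∃ n, R n z}` of Baire
space. -/
noncomputable def semidecider (R : ℕ → Baire → Prop) : Baire :=
  localAssociate fun n z => if R n z then 1 else 0

theorem isLocal_semidecider {R : ℕ → Baire → Baire → Prop} (hR : IsLocal R) :
    IsLocal fun c p => semidecider (fun n => R n p) c := by
  classical
  exact isLocal_localAssociate (A := fun n p z => if R n p z then 1 else 0)
    fun n p p' h => by simp only [hR n h]

theorem primrec_semidecider {α : Type*} [Primcodable α] {R : α → ℕ → Baire → Prop}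
    (hR : PrimrecPred fun x : α × ℕ × List ℕ => R x.1 x.2.1 (word x.2.2)) :
    Primrec₂ fun x => semidecider (R x) := by
  classical
  exact primrec_localAssociate (A := fun x n z => if R x n z then 1 else 0)
    (Primrec.ite hR (Primrec.const 1) (Primrec.const 0))

theorem openName_semidecider {X : Type*} {δ : Representation X} {R : ℕ → Baire → Prop}
    (hR : IsLocal R) {U : OpenSets δ}
    (hU : ∀ p, ∀ x ∈ δ.toPFun p, (∃ n, R n p) ↔ x ∈ U.1) : OpenName δ (semidecider R) U := by
  classical
  intro p x y hx hy
  obtain rfl : y = (x ∈ U.1) := by simpa using hy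
  refine ⟨_, mem_eta_localAssociate (fun n z z' h => by simp only [hR n h]) p, ?_⟩
  simp [sierpinskiRep, hU p x hx]

end Semideciders

section Acceptance

theorem ne_zero_iff_of_mem_eta {q p r : Baire} (hr : r ∈ eta q p) (i : ℕ) :
    r i ≠ 0 ↔ ∃ k, (∀ j < k, q (prefixCode i p j) = 0) ∧ 1 < q (prefixCode i p k) := by
  obtain ⟨k, hk, hzero⟩ := (mem_eta_iff q p r).1 hr i
  constructor
  · exact fun hi => ⟨k, hzero, by omega⟩
  · rintro ⟨k', hzero', hk'⟩
    obtain rfl : k = k' := by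
      rcases lt_trichotomy k k' with h | h | h
      · have := hzero' k h; omega
      · exact h
      · have := hzero k' h; omega
    omega

/-- `Accepts n q p` says that `n` steps suffice to find a nonzero value of `η_q(p)`. The bound on
the codes makes sure that only the first `n` values of `q` and of `p` are inspected. -/
def Accepts (n : ℕ) (q p : Baire) : Prop :=
  ∃ i < n, ∃ k < n, (∀ j < k + 1, prefixCode i p j < n) ∧
    (∀ j < k, q (prefixCode i p j) = 0) ∧ 1 < q (prefixCode i p k)

theorem Accepts.of_mem_cylinder {n : ℕ} {q q' p p' : Baire} (hq : q' ∈ cylinder q n)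
    (hp : p' ∈ cylinder p n) (h : Accepts n q p) : Accepts n q' p' := by
  obtain ⟨i, hi, k, hk, hcode, hzero, hone⟩ := h
  have hcode_eq (j : ℕ) (hj : j < k + 1) : prefixCode i p' j = prefixCode i p j :=
    prefixCode_congr (cylinder_anti p (by omega) hp) i
  have hq_eq (j : ℕ) (hj : j < k + 1) : q' (prefixCode i p' j) = q (prefixCode i p j) := by
    rw [hcode_eq j hj, hq _ (hcode j hj)]
  refine ⟨i, hi, k, hk, fun j hj => ?_, fun j hj => ?_, ?_⟩
  · exact hcode_eq j hj ▸ hcode j hj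
  · exact (hq_eq j (by omega)).trans (hzero j hj)
  · exact hq_eq k (by omega) ▸ hone

theorem isLocal_accepts : IsLocal Accepts := fun n _ _ hq =>
  funext fun p => IsLocal.of_imp (R := fun n q => Accepts n q p)
    (fun _ _ _ hq => Accepts.of_mem_cylinder hq (self_mem_cylinder _ _)) n hq

theorem isLocal_accepts_right (q : Baire) : IsLocal fun n => Accepts n q :=
  IsLocal.of_imp fun _ _ _ => Accepts.of_mem_cylinder (self_mem_cylinder _ _)

theorem exists_accepts_iff {q p r : Baire} (hr : r ∈ eta q p) :
    (∃ n, Accepts n q p) ↔ ∃ i, r i ≠ 0 := by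
  simp only [ne_zero_iff_of_mem_eta hr]
  constructor
  · rintro ⟨_, i, _, k, _, _, hk⟩
    exact ⟨i, k, hk⟩
  · rintro ⟨i, k, hk⟩
    obtain ⟨N, hN⟩ := ((Set.finite_Iio (k + 1)).image (prefixCode i p)).bddAbove
    refine ⟨max N (max i k) + 1, i, by omega, k, by omega, fun j hj => ?_, hk⟩
    have := hN (Set.mem_image_of_mem (prefixCode i p) hj)
    omega

theorem OpenName.exists_accepts_iff {X : Type*} {δ : Representation X} {q p : Baire}
    {U : OpenSets δ} {x : X} (hq : OpenName δ q U) (hp : x ∈ δ.toPFun p) :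
    (∃ n, Accepts n q p) ↔ x ∈ U.1 := by
  obtain ⟨r, hr, hU⟩ := hq.exists_iff hp
  rw [CompAn.exists_accepts_iff hr, hU]

theorem OpenName.eventually_exists_accepts {X : Type*} {δ : Representation X} {q p : Baire}
    {U : OpenSets δ} {x : X} (hq : OpenName δ q U) (hp : x ∈ δ.toPFun p) (hx : x ∈ U.1) :
    ∀ᶠ a : Baire × Baire in 𝓝 (q, p), ∃ n, Accepts n a.1 a.2 :=
  (isOpen_setOf_exists_of_isLocal isLocal_accepts isLocal_accepts_right).mem_nhds
    ((hq.exists_accepts_iff hp).2 hx)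

theorem primrecRel_forall_lt {α : Type*} [Primcodable α] {R : ℕ → α → Prop} (hR : PrimrecRel R) :
    PrimrecRel fun k x => ∀ j < k, R j x :=
  (hR.forall_mem_list.comp (Primrec.list_range.comp Primrec.fst) Primrec.snd).of_eq (by simp)

theorem primrecRel_exists_lt {α : Type*} [Primcodable α] {R : ℕ → α → Prop} (hR : PrimrecRel R) :
    PrimrecRel fun k x => ∃ j < k, R j x :=
  (hR.exists_mem_list.comp (Primrec.list_range.comp Primrec.fst) Primrec.snd).of_eq (by simp)

theorem primrecPred_accepts {α : Type*} [Primcodable α] {n : α → ℕ} {f g : α → Baire}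
    (hn : Primrec n) (hf : Primrec₂ f) (hg : Primrec₂ g) :
    PrimrecPred fun x => Accepts (n x) (f x) (g x) := by
  have hx : Primrec fun a : ℕ × ℕ × α => a.2.2 := Primrec.snd.comp Primrec.snd
  have hcode : Primrec fun a : ℕ × ℕ × α => prefixCode a.2.1 (g a.2.2) a.1 :=
    primrec_prefixCode (Primrec.fst.comp Primrec.snd) (hg.comp (hx.comp Primrec.fst) Primrec.snd)
      Primrec.fst
  have hbound : PrimrecRel fun (j : ℕ) (b : ℕ × α) => prefixCode b.1 (g b.2) j < n b.2 :=
    Primrec.nat_lt.comp hcode (hn.comp hx)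
  have hzero : PrimrecRel fun (j : ℕ) (b : ℕ × α) => f b.2 (prefixCode b.1 (g b.2) j) = 0 :=
    Primrec.eq.comp (hf.comp hx hcode) (Primrec.const 0)
  have hone : PrimrecRel fun (k : ℕ) (b : ℕ × α) => 1 < f b.2 (prefixCode b.1 (g b.2) k) :=
    Primrec.nat_lt.comp (Primrec.const 1) (hf.comp hx hcode)
  have hhalt : PrimrecRel fun (k : ℕ) (b : ℕ × α) =>
      (∀ j < k + 1, prefixCode b.1 (g b.2) j < n b.2) ∧
        (∀ j < k, f b.2 (prefixCode b.1 (g b.2) j) = 0) ∧ 1 < f b.2 (prefixCode b.1 (g b.2) k) :=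
    PrimrecPred.and
      ((primrecRel_forall_lt hbound).comp (Primrec.succ.comp Primrec.fst) Primrec.snd)
      (PrimrecPred.and (primrecRel_forall_lt hzero) hone)
  have hfound : PrimrecRel fun (i : ℕ) (x : α) => ∃ k < n x,
      (∀ j < k + 1, prefixCode i (g x) j < n x) ∧
        (∀ j < k, f x (prefixCode i (g x) j) = 0) ∧ 1 < f x (prefixCode i (g x) k) :=
    (primrecRel_exists_lt hhalt).comp (hn.comp Primrec.snd) Primrec.id
  exact (primrecRel_exists_lt hfound).comp hn Primrec.id

end Acceptance

section Evaluation

/-- From a name `p` of a point, a name of the set of its open neighbourhoods: on input `q` it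
searches for a nonzero value of `η_q(p)`. -/
noncomputable def evalName (p : Baire) : Baire :=
  semidecider fun n q => Accepts n q p

/-- From a name `s` of a set of open sets, a name of its preimage under any map into the open sets
that `evalName` realizes. -/
noncomputable def evalPreimageName (s : Baire) : Baire :=
  semidecider fun n z => Accepts n s (evalName z)

theorem isLocal_evalName : IsLocal fun n p => evalName p n :=
  isLocal_semidecider fun n _ _ hp => funext fun q => isLocal_accepts_right q n hp

theorem isLocal_evalPreimageName : IsLocal fun n s => evalPreimageName s n :=
  isLocal_semidecider fun n _ _ hs => funext fun z => congrFun (isLocal_accepts n hs) (evalName z)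

theorem primrec_evalName {α : Type*} [Primcodable α] {f : α → Baire} (hf : Primrec₂ f) :
    Primrec₂ fun x => evalName (f x) :=
  primrec_semidecider <| primrecPred_accepts (Primrec.fst.comp Primrec.snd)
    (primrec_word.comp (Primrec.snd.comp (Primrec.snd.comp Primrec.fst)) Primrec.snd)
    (hf.comp (Primrec.fst.comp Primrec.fst) Primrec.snd)

theorem isComputable_evalName : IsComputable (evalName : Baire →. Baire) :=
  isLocal_evalName.isComputable (primrec_evalName primrec_word)

theorem isComputable_evalPreimageName : IsComputable (evalPreimageName : Baire →. Baire) :=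
  isLocal_evalPreimageName.isComputable <| primrec_semidecider <|
    primrecPred_accepts (Primrec.fst.comp Primrec.snd)
      (primrec_word.comp (Primrec.fst.comp Primrec.fst) Primrec.snd)
      (primrec_evalName
        (primrec_word.comp (Primrec.snd.comp (Primrec.snd.comp Primrec.fst)) Primrec.snd))

theorem openName_evalName {X Y : Type*} {δX : Representation X} {δY : Representation Y}
    {z : Baire} {U : OpenSets δX} {W : X → OpenSets δY} {y : Y} (hy : y ∈ δY.toPFun z)
    (hW : ∀ p, ∀ x ∈ δX.toPFun p, OpenName δY p (W x)) (hU : ∀ x, x ∈ U.1 ↔ y ∈ (W x).1) :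
    OpenName δX (evalName z) U :=
  openName_semidecider (fun n _ _ hp => congrFun (isLocal_accepts n hp) z) fun p x hx =>
    ((hW p x hx).exists_accepts_iff hy).trans (hU x).symm

theorem openName_evalPreimageName {X Y : Type*} {δX : Representation X} {δY : Representation Y}
    {s : Baire} {S : OpenSets (openRep δX)} {U : OpenSets δY} {f : Y → OpenSets δX}
    (hs : OpenName (openRep δX) s S)
    (hf : ∀ z, ∀ y ∈ δY.toPFun z, OpenName δX (evalName z) (f y))
    (hU : ∀ y, y ∈ U.1 ↔ f y ∈ S.1) : OpenName δY (evalPreimageName s) U := by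
  refine openName_semidecider (fun n z z' hz => ?_) fun z y hy => ?_
  · exact isLocal_accepts_right s n fun i hi => isLocal_evalName i (cylinder_anti z hi.le hz)
  · rw [hs.exists_accepts_iff ((mem_openRep _ _ _).2 (hf z y hy)), hU]

theorem realizes_coe {X Y : Type*} {δX : Representation X} {δY : Representation Y}
    {Φ : Baire → Baire} {f : X →. Y}
    (h : ∀ p, ∀ x ∈ δX.toPFun p, ∀ y ∈ f x, y ∈ δY.toPFun (Φ p)) :
    Realizes δX δY (Φ : Baire →. Baire) f :=
  fun p x y hx hy => ⟨Φ p, by simp, h p x hx y hy⟩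

theorem computableRepMap_neighbourhoodMap {X : Type*} (δ : Representation X) :
    ComputableRepMap δ (openRep (openRep δ)) (neighbourhoodMap δ : X →. OpenSets (openRep δ)) := by
  refine ⟨_, isComputable_evalName, realizes_coe fun p x hx y hy => ?_⟩
  obtain rfl : y = neighbourhoodMap δ x := by simpa using hy
  rw [mem_openRep]
  exact openName_evalName (W := id) hx (fun q U => (mem_openRep δ q U).1) fun U => Iff.rfl

end Evaluation

section FinalTopology

variable {X : Type*} (δ : Representation X)

theorem Representation.isOpen_finalTopology_iff {S : Set X} :
    IsOpen[δ.finalTopology] S ↔ ∀ p, ∀ x ∈ δ.toPFun p, x ∈ S →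
      ∀ᶠ p' in 𝓝 p, ∀ x' ∈ δ.toPFun p', x' ∈ S := by
  rw [isOpen_coinduced, isOpen_iff_mem_nhds]
  have mem_nhds_iff (a : δ.toPFun.Dom) : δ.toPFun.asSubtype ⁻¹' S ∈ 𝓝 a ↔
      ∀ᶠ p' in 𝓝 a.1, ∀ x' ∈ δ.toPFun p', x' ∈ S := by
    rw [nhds_subtype_eq_comap, ← Filter.eventually_mem_set, eventually_comap]
    refine eventually_congr (Eventually.of_forall fun p' => ⟨?_, ?_⟩)
    · rintro h _ ⟨hp', rfl⟩
      exact h ⟨p', hp'⟩ rfl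
    · rintro h ⟨_, hp'⟩ rfl
      exact h _ ⟨hp', rfl⟩
  simp only [mem_nhds_iff]
  constructor
  · rintro h p _ ⟨hp, rfl⟩ hpS
    exact h ⟨p, hp⟩ hpS
  · exact fun h a ha => h a.1 _ ⟨a.2, rfl⟩ ha

theorem Representation.tendsto_finalTopology {ι : Type*} {l : Filter ι} {p : ι → Baire}
    {p₀ : Baire} {x : ι → X} {x₀ : X} (hp : Tendsto p l (𝓝 p₀))
    (hx : ∀ i, x i ∈ δ.toPFun (p i)) (hx₀ : x₀ ∈ δ.toPFun p₀) :
    Tendsto x l (@nhds X δ.finalTopology x₀) := by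
  let _ := δ.finalTopology
  exact tendsto_nhds.2 fun S hS hxS =>
    (hp.eventually (δ.isOpen_finalTopology_iff.1 hS p₀ x₀ hx₀ hxS)).mono fun i hi => hi _ (hx i)

theorem isOpen_biInter_image_openRep_of_isCompact {C : Set Baire} (hC : IsCompact C)
    (hdom : C ⊆ (openRep δ).toPFun.Dom) :
    IsOpen[δ.finalTopology] (⋂ U ∈ (openRep δ).toPFun.image C, U.1) := by
  rw [δ.isOpen_finalTopology_iff]
  intro z y hz hy
  have haccept : ∀ᶠ z' in 𝓝 z, ∀ q ∈ C, ∃ n, Accepts n q z' := by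
    refine hC.eventually_forall_of_forall_eventually fun q hq => ?_
    obtain ⟨U, hU⟩ := Part.dom_iff_mem.1 (hdom hq)
    have hyU : y ∈ U.1 := Set.mem_iInter₂.1 hy U ((PFun.mem_image _ _ _).2 ⟨q, hq, hU⟩)
    exact (continuous_swap.tendsto (z, q)).eventually
      (((mem_openRep δ q U).1 hU).eventually_exists_accepts hz hyU)
  refine haccept.mono fun z' hz' y' hy' => Set.mem_iInter₂.2 fun U hU => ?_
  obtain ⟨q, hq, hqU⟩ := (PFun.mem_image _ _ _).1 hU
  exact (((mem_openRep δ q U).1 hqU).exists_accepts_iff hy').1 (hz' q hq)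

theorem exists_mem_biInter_image_openRep_of_tendsto {q : ℕ → Baire} {q₀ : Baire} {U : OpenSets δ}
    (hq : Tendsto q atTop (𝓝 q₀)) (hU : OpenName δ q₀ U) {y : X} (hy : y ∈ U.1) :
    ∃ n, y ∈ ⋂ V ∈ (openRep δ).toPFun.image (insert q₀ (Set.range fun m => q (m + n))), V.1 := by
  obtain ⟨z, hz⟩ := δ.surj y
  have hnear : ∀ᶠ q' in 𝓝 q₀, ∃ n, Accepts n q' z :=
    ((Continuous.prodMk_left z).tendsto q₀).eventually (hU.eventually_exists_accepts hz hy)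
  obtain ⟨n, hn⟩ := eventually_atTop.1 (hq.eventually hnear)
  refine ⟨n, Set.mem_iInter₂.2 fun V hV => ?_⟩
  obtain ⟨q', hq', hqV⟩ := (PFun.mem_image _ _ _).1 hV
  refine (((mem_openRep δ q' V).1 hqV).exists_accepts_iff hz).1 ?_
  rcases hq' with rfl | ⟨m, rfl⟩
  exacts [hnear.self_of_nhds, hn _ (Nat.le_add_left n m)]

theorem exists_subset_of_tendsto_openName {K : Set X}
    (hK : @IsCountablyCompact X δ.finalTopology K) {q : ℕ → Baire} {q₀ : Baire}
    {V : ℕ → OpenSets δ} {U : OpenSets δ} (hq : Tendsto q atTop (𝓝 q₀))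
    (hV : ∀ m, OpenName δ (q m) (V m)) (hU : OpenName δ q₀ U) (hKU : K ⊆ U.1) :
    ∃ n, K ⊆ (V n).1 := by
  let _ := δ.finalTopology
  let C (n : ℕ) : Set Baire := insert q₀ (Set.range fun m => q (m + n))
  let W (n : ℕ) : Set X := ⋂ U ∈ (openRep δ).toPFun.image (C n), U.1
  have hWo (n : ℕ) : IsOpen (W n) := by
    refine isOpen_biInter_image_openRep_of_isCompact δ
      ((tendsto_add_atTop_iff_nat n).2 hq).isCompact_insert_range ?_
    rintro _ (rfl | ⟨m, rfl⟩)
    exacts [Part.dom_iff_mem.2 ⟨U, (mem_openRep _ _ _).2 hU⟩,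
      Part.dom_iff_mem.2 ⟨_, (mem_openRep _ _ _).2 (hV _)⟩]
  have hWmono : Monotone W := fun a b hab =>
    Set.biInter_subset_biInter_left <| PFun.image_mono _ <| Set.insert_subset_insert <| by
      rintro _ ⟨m, rfl⟩
      exact ⟨m + (b - a), congrArg q (by omega)⟩
  have hcover : K ⊆ ⋃ n, W n := fun y hy =>
    Set.mem_iUnion.2 (exists_mem_biInter_image_openRep_of_tendsto δ hq hU (hKU hy))
  obtain ⟨n, hn⟩ := hK.elim_directed_cover W hWo hcover hWmono.directed_le
  have hVn : V n ∈ (openRep δ).toPFun.image (C n) :=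
    (PFun.mem_image _ _ _).2 ⟨q n, Or.inr ⟨0, by simp⟩, (mem_openRep _ _ _).2 (hV n)⟩
  exact ⟨n, hn.trans (Set.biInter_subset_of_mem hVn)⟩

theorem isOpen_setOf_superset_of_isCountablyCompact {K : Set X}
    (hK : @IsCountablyCompact X δ.finalTopology K) :
    IsOpen[(openRep δ).finalTopology] {U : OpenSets δ | K ⊆ U.1} := by
  rw [(openRep δ).isOpen_finalTopology_iff]
  intro q₀ U hU hKU
  by_contra hnot
  obtain ⟨q, hq, hbad⟩ := exists_seq_forall_of_frequently (not_eventually.1 hnot)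
  push Not at hbad
  choose V hV hKV using hbad
  obtain ⟨n, hn⟩ := exists_subset_of_tendsto_openName δ hK hq
    (fun m => (mem_openRep δ _ _).1 (hV m)) ((mem_openRep δ q₀ U).1 hU) hKU
  exact hKV n hn

end FinalTopology

section Presubbase

variable {X Y : Type*} {δY : Representation Y} {B : Y → Set X}

theorem openName_transpose (hB : IsPresubbase δY B) {p : Baire} {x : X}
    (hx : x ∈ (presubbaseRep hB).toPFun p) : OpenName δY p (transpose hB x) :=
  (mem_openRep _ _ _).1 ((mem_presubbaseRep hB p x).1 hx)

theorem isOpen_preimage_transpose (hB : IsPresubbase δY B) {S : Set (OpenSets δY)}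
    (hS : IsOpen[(openRep δY).finalTopology] S) :
    IsOpen[(presubbaseRep hB).finalTopology] (transpose hB ⁻¹' S) := by
  rw [Representation.isOpen_finalTopology_iff] at hS ⊢
  intro p x hx hxS
  exact (hS p _ ((mem_presubbaseRep hB p x).1 hx) hxS).mono fun p' hp' x' hx' =>
    hp' _ ((mem_presubbaseRep hB p' x').1 hx')

/-- The members of a presubbase, as open sets of the presubbase representation. -/
def presubbaseOpen (hB : IsPresubbase δY B) (y : Y) : OpenSets (presubbaseRep hB) :=
  ⟨B y, isOpen_preimage_transpose hB (isOpen_neighbourhoods δY y)⟩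

theorem injective_neighbourhoodMap_presubbaseRep (hB : IsPresubbase δY B) :
    Function.Injective (neighbourhoodMap (presubbaseRep hB)) := fun _ _ h =>
  hB.injective <| Set.ext fun y => Set.ext_iff.1 (congrArg Subtype.val h) (presubbaseOpen hB y)

theorem computableRepMap_partialInverse_neighbourhoodMap (hB : IsPresubbase δY B) :
    ComputableRepMap (openRep (openRep (presubbaseRep hB))) (presubbaseRep hB)
      (partialInverse (neighbourhoodMap (presubbaseRep hB))) := by
  refine ⟨_, isComputable_evalPreimageName, realizes_coe ?_⟩
  rintro s _ hs _ ⟨hrange, rfl⟩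
  rw [← hrange.choose_spec, mem_openRep] at hs
  rw [mem_presubbaseRep, mem_openRep]
  exact openName_evalPreimageName (f := presubbaseOpen hB) hs
    (fun z y hy => openName_evalName hy (fun _ _ => openName_transpose hB) fun _ => Iff.rfl)
    fun _ => Iff.rfl

theorem isComputableKolmogorov_presubbaseRep (hB : IsPresubbase δY B) :
    (presubbaseRep hB).IsComputableKolmogorov :=
  ⟨injective_neighbourhoodMap_presubbaseRep hB, computableRepMap_neighbourhoodMap _,
    computableRepMap_partialInverse_neighbourhoodMap hB⟩

theorem mem_compactIntersections {A : Set X} : A ∈ compactIntersections δY B ↔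
    ∃ K : Set Y, @IsCompact Y δY.finalTopology K ∧ A = ⋂ y ∈ K, B y := by
  refine or_iff_right_of_imp ?_
  rintro rfl
  exact ⟨∅, @isCompact_empty Y δY.finalTopology, by simp⟩

theorem isTopologicalBasis_compactIntersections (δY : Representation Y) (B : Y → Set X) :
    @TopologicalSpace.IsTopologicalBasis X (compactIntersectionTopology δY B)
      (compactIntersections δY B) := by
  let _ := compactIntersectionTopology δY B
  have hinter : ∀ ⦃s⦄, s ∈ compactIntersections δY B → ∀ ⦃t⦄, t ∈ compactIntersections δY B →
      s ∩ t ∈ compactIntersections δY B := by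
    simp only [mem_compactIntersections]
    rintro _ ⟨K, hK, rfl⟩ _ ⟨L, hL, rfl⟩
    exact ⟨K ∪ L, @IsCompact.union Y δY.finalTopology _ _ hK hL, (Set.biInter_union K L B).symm⟩
  have huniv : Set.univ ∈ compactIntersections δY B := Or.inl rfl
  exact Set.insert_eq_of_mem huniv ▸
    TopologicalSpace.isTopologicalBasis_of_subbasis_of_inter rfl hinter

theorem Representation.continuousWrt_iff {δ : Representation X} {τ : TopologicalSpace X} :
    δ.ContinuousWrt τ ↔ δ.finalTopology ≤ τ :=
  continuous_iff_coinduced_le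

theorem continuousWrt_presubbaseRep (hB : IsPresubbase δY B) :
    (presubbaseRep hB).ContinuousWrt (compactIntersectionTopology δY B) := by
  refine Representation.continuousWrt_iff.2 (le_generateFrom fun A hA => ?_)
  obtain ⟨K, hK, rfl⟩ := mem_compactIntersections.1 hA
  have hpreimage : ⋂ y ∈ K, B y = transpose hB ⁻¹' {U : OpenSets δY | K ⊆ U.1} := by
    ext x
    exact Set.mem_iInter₂
  rw [hpreimage]
  exact isOpen_preimage_transpose hB (isOpen_setOf_superset_of_isCountablyCompact δY
    (@IsCompact.isCountablyCompact Y δY.finalTopology K hK))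

theorem eventually_mem_of_continuousWrt (hB : IsPresubbase δY B) {δ : Representation X}
    (hδ : δ.ContinuousWrt (compactIntersectionTopology δY B)) {p z : Baire} {x : X} {y : Y}
    (hx : x ∈ δ.toPFun p) (hy : y ∈ δY.toPFun z) (hxy : x ∈ B y) :
    ∀ᶠ a : Baire × Baire in 𝓝 (p, z), ∀ x' ∈ δ.toPFun a.1, ∀ y' ∈ δY.toPFun a.2, x' ∈ B y' := by
  let _ := δY.finalTopology
  by_contra hnot
  obtain ⟨a, ha, hbad⟩ := exists_seq_forall_of_frequently (not_eventually.1 hnot)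
  push Not at hbad
  choose ξ hξ υ hυ hξυ using hbad
  have hυy : Tendsto υ atTop (𝓝 y) := δY.tendsto_finalTopology ha.snd_nhds hυ hy
  obtain ⟨N, hN⟩ := eventually_atTop.1 (hυy.eventually ((hB.isOpen x).mem_nhds hxy))
  let K : Set Y := insert y (Set.range fun n => υ (n + N))
  have hK : IsCompact K := ((tendsto_add_atTop_iff_nat N).2 hυy).isCompact_insert_range
  have hxK : x ∈ ⋂ y' ∈ K, B y' := by
    refine Set.mem_iInter₂.2 ?_
    rintro y' (rfl | ⟨n, rfl⟩)
    exacts [hxy, hN _ (Nat.le_add_left N n)]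
  have hopen : IsOpen[δ.finalTopology] (⋂ y' ∈ K, B y') :=
    Representation.continuousWrt_iff.1 hδ _
      (TopologicalSpace.isOpen_generateFrom_of_mem (mem_compactIntersections.2 ⟨K, hK, rfl⟩))
  have hξK : ∀ᶠ n in atTop, ξ n ∈ ⋂ y' ∈ K, B y' :=
    (ha.fst_nhds.eventually (δ.isOpen_finalTopology_iff.1 hopen p x hx hxK)).mono
      fun n hn => hn _ (hξ n)
  obtain ⟨n, hn, hNn⟩ := (hξK.and (eventually_ge_atTop N)).exists
  exact hξυ n (Set.mem_iInter₂.1 hn (υ n) (Or.inr ⟨n - N, congrArg υ (Nat.sub_add_cancel hNn)⟩))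

theorem isAdmissible_presubbaseRep (hB : IsPresubbase δY B) :
    (presubbaseRep hB).IsAdmissible (compactIntersectionTopology δY B) := by
  refine ⟨continuousWrt_presubbaseRep hB, fun δ hδ => ?_⟩
  let G : Set (Baire × Baire) := {a | ∀ x ∈ δ.toPFun a.1, ∀ y ∈ δY.toPFun a.2, x ∈ B y}
  let R (n : ℕ) (p z : Baire) : Prop := cylinder p n ×ˢ cylinder z n ⊆ G
  have hR : IsLocal R := fun n p p' hp => by simp only [R, mem_cylinder_iff_eq.1 hp]
  have hR' (p : Baire) : IsLocal fun n => R n p :=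
    fun n z z' hz => by simp only [R, mem_cylinder_iff_eq.1 hz]
  refine ⟨fun p => semidecider fun n => R n p,
    (isLocal_semidecider hR).continuous.comp continuous_subtype_val, realizes_coe ?_⟩
  intro p p₀ hp x hx
  obtain rfl : p₀ = p := by simpa [baireRep] using hp
  rw [mem_presubbaseRep, mem_openRep]
  refine openName_semidecider (hR' p₀) fun z y hy => exists_cylinder_prod_subset_iff.trans ?_
  exact ⟨fun hG => mem_of_mem_nhds hG x hx y hy,
    fun hxy => eventually_mem_of_continuousWrt hB hδ hx hy hxy⟩

end Presubbase

end CompAn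

theorem theorem7 {X : Type*} {Y : Type*} (δY : CompAn.Representation Y) (B : Y → Set X)
    (hB : CompAn.IsPresubbase δY B) :
    (CompAn.presubbaseRep hB).IsComputableKolmogorov ∧
    @TopologicalSpace.IsTopologicalBasis X (CompAn.compactIntersectionTopology δY B)
      (CompAn.compactIntersections δY B) ∧
    (CompAn.presubbaseRep hB).IsAdmissible (CompAn.compactIntersectionTopology δY B) :=
  ⟨CompAn.isComputableKolmogorov_presubbaseRep hB,
    CompAn.isTopologicalBasis_compactIntersections δY B, CompAn.isAdmissible_presubbaseRep hB⟩
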